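/- Let $l\ge 1$ be an integer and $\lambda_0>0$. A \emph{homogeneous $l$-D shotgun cellular system} with base station density $\lambda_0$ is a homogeneous Poisson point process $\Phi$ in $\mathbb{R}^l$ with intensity $\lambda_0$, whose points are the base stations. A mobile station at the origin receives from a base station at $x$ the power $1/h(|x|)$ (unit transmission powers and no fading), where $1/h(r)$ is the path-loss model. It is served by a base station $S\in\Phi$ of strongest received power, and all others interfere, so that $$\frac{C}{I}=\frac{1/h(|S|)}{\sum_{x\in\Phi\setminus\{S\}}1/h(|x|)} .$$ For real random variables $X,Y$ write $X\ge_{\mathrm{st}}Y$ if $\mathbb{P}(X>x)\ge\mathbb{P}(Y>x)$ for all $x\in\mathbb{R}$. Let $\varepsilon_1>\varepsilon_2>l$ and $h_i(r)=r^{\varepsilon_i}$, and let $\left(\frac{C}{I}\right)_i$, $i=1,2$, be the ratio under the path-loss model $1/h_i(r)=r^{-\varepsilon_i}$ in a homogeneous $l$-D shotgun cellular system with base station density $\lambda_0$ (the two systems may be the same or different, possibly on different probability spaces). Then both ratios are almost surely well defined (no base station is at the origin, a serving base station exists, and the interference series converges to a positive number), and $$\left(\frac{C}{I}\right)_1\ \ge_{\mathrm{st}}\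 \left(\frac{C}{I}\right)_2 .$$ -/

import Mathlib

open MeasureTheory ProbabilityTheory

namespace Shotgun

/-- The number of points of the configuration `φ` that lie in `B`. -/
noncomputable def count {E : Type*} (φ B : Set E) : ℕ∞ := (φ ∩ B).encard

/-- `Φ` is a (simple) Poisson point process on `E` with intensity measure `ν`, under the
probability measure `P`: a random countable set of points such that the number of points in
a measurable set of finite intensity is Poisson distributed with mean `ν B`, and the numbers of
points in finitely many pairwise disjoint measurable sets are independent. -/
structure IsPoissonPointProcess {E Ω : Type*} [MeasurableSpace E] [MeasurableSpace Ω]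
    (Φ : Ω → Set E) (ν : Measure E) (P : Measure Ω) : Prop where
  countable : ∀ ω, (Φ ω).Countable
  measurable_count : ∀ B : Set E, MeasurableSet B → Measurable fun ω => count (Φ ω) B
  map_count : ∀ B : Set E, MeasurableSet B → ν B ≠ ⊤ →
    P.map (fun ω => count (Φ ω) B) =
      (poissonMeasure (ν B).toNNReal).map (fun n : ℕ => (n : ℕ∞))
  indep_count : ∀ (n : ℕ) (B : Fin n → Set E), (∀ i, MeasurableSet (B i)) →
    Pairwise (fun i j => Disjoint (B i) (B j)) →
    iIndepFun (fun (i : Fin n) (ω : Ω) => count (Φ ω) (B i)) P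

/-- The homogeneous `l`-dimensional shotgun cellular system with base station density `lam`:
the base stations form a Poisson point process in `ℝ^l` with constant intensity `lam`. -/
def IsHomogeneousSCS {l : ℕ} {Ω : Type*} [MeasurableSpace Ω]
    (Φ : Ω → Set (EuclideanSpace ℝ (Fin l))) (lam : ℝ) (P : Measure Ω) : Prop :=
  IsPoissonPointProcess Φ (ENNReal.ofReal lam • volume) P

section Configuration

variable {E : Type*} [NormedAddCommGroup E]

/-- The power received at the origin from a base station at `x`, with unit transmission power and
unit fading, under the path-loss model `1 / h(r)`. -/
noncomputable def receivedPower (h : ℝ → ℝ) (x : E) : ℝ := 1 / h ‖x‖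

/-- `s` is a base station of `φ` with the strongest received power at the origin. -/
def IsServing (h : ℝ → ℝ) (φ : Set E) (s : E) : Prop :=
  s ∈ φ ∧ ∀ x ∈ φ, receivedPower h x ≤ receivedPower h s

open Classical in
/-- The serving base station: a base station with the strongest received power (ties broken
arbitrarily), and the junk value `0` if there is none. -/
noncomputable def servingBS (h : ℝ → ℝ) (φ : Set E) : E :=
  if hs : ∃ s, IsServing h φ s then hs.choose else 0

/-- The total power received from all base stations other than the serving one. -/
noncomputable def interference (h : ℝ → ℝ) (φ : Set E) : ℝ :=
  ∑' x : ↥(φ \ {servingBS h φ}), receivedPower h (x : E)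

/-- The carrier-to-interference ratio at the mobile station located at the origin. -/
noncomputable def carrierToInterference (h : ℝ → ℝ) (φ : Set E) : ℝ :=
  receivedPower h (servingBS h φ) / interference h φ

/-- No junk value enters the carrier-to-interference ratio: no base station is at the origin, where
the path-loss is singular, a strongest base station exists, the interference is a convergent series,
and its sum is positive. -/
structure RatioWellDefined (h : ℝ → ℝ) (φ : Set E) : Prop where
  zero_notMem : (0 : E) ∉ φ
  exists_serving : ∃ s, IsServing h φ s
  summable : Summable fun x : ↥(φ \ {servingBS h φ}) => receivedPower h (x : E)
  interference_pos : 0 < interference h φ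

end Configuration

/-- The power law `h(r) = r ^ ε`, for which the path-loss `1 / h(r)` is `r ^ (-ε)`. -/
noncomputable def powerLaw (ε : ℝ) (r : ℝ) : ℝ := r ^ ε

/-- `X ≤_st Y`: the random variable `X` (under `P`) is smaller than the random variable `Y`
(under `Q`) in the usual stochastic order. -/
structure StochLE {Ω Ω' : Type*} [MeasurableSpace Ω] [MeasurableSpace Ω']
    (X : Ω → ℝ) (P : Measure Ω) (Y : Ω' → ℝ) (Q : Measure Ω') : Prop where
  aemeasurable_left : AEMeasurable X P
  aemeasurable_right : AEMeasurable Y Q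
  tail_le : ∀ x : ℝ, P {ω | x < X ω} ≤ Q {ω | x < Y ω}

end Shotgun

/-! Fix one configuration without a point at the origin. For every positive exponent ε a strongest
station is a nearest one, and with S serving, I/C is the sum of (|S|/|x|)^ε over the other stations.
Each base is at most 1, so raising ε lowers every term and raises C/I: this is
`carrierToInterference_powerLaw_mono`.

Different systems are compared through laws. Almost surely C/I is a measurable function,
`ratioOfMeasure`, of the counting measure of the stations. The law of that random measure is fixed
by the intensity, since the counts on disjoint sets are independent with prescribed laws. So the
second ratio may be computed on the first system (`identDistrib_carrierToInterference`), where the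
pointwise comparison applies.

The ratio is well defined because bounded sets have finite mean count, the whole space has infinite
intensity and hence infinitely many points, and Campbell's theorem with ε > l makes the total power
finite. -/

namespace Shotgun

open scoped ENNReal NNReal

/-! ### Mean of the Poisson law -/

section PoissonMean

theorem lintegral_natCast_poissonMeasure (r : ℝ≥0) :
    ∫⁻ n : ℕ, (n : ℝ≥0∞) ∂(poissonMeasure r) = r := by
  have hshift : ∀ n : ℕ,
      ENNReal.ofReal (Real.exp (-r) * (r : ℝ) ^ (n + 1) / (Nat.factorial (n + 1) : ℝ)) *
        ((n + 1 : ℕ) : ℝ≥0∞) =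
      r * ENNReal.ofReal (Real.exp (-r) * (r : ℝ) ^ n / (Nat.factorial n : ℝ)) := by
    intro n
    rw [← ENNReal.ofReal_natCast, ← ENNReal.ofReal_coe_nnreal (p := r),
      ← ENNReal.ofReal_mul (by positivity), ← ENNReal.ofReal_mul (by positivity)]
    congr 1
    rw [Nat.factorial_succ]
    push_cast
    field_simp
    ring
  have hone : ∑' n : ℕ, ENNReal.ofReal (Real.exp (-r) * (r : ℝ) ^ n / (Nat.factorial n : ℝ)) = 1 := by
    have h := hasSum_one_poissonMeasure r
    rw [← ENNReal.ofReal_tsum_of_nonneg (fun n => by positivity) h.summable, h.tsum_eq,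
      ENNReal.ofReal_one]
  rw [poissonMeasure, lintegral_sum_measure]
  simp only [lintegral_smul_measure, lintegral_dirac, smul_eq_mul]
  rw [tsum_eq_zero_add' ENNReal.summable]
  simp_rw [hshift, ENNReal.tsum_mul_left, hone]
  simp

end PoissonMean

/-- The counting measure of a configuration of points. -/
noncomputable def countingMeasure {E : Type*} [MeasurableSpace E] (φ : Set E) : Measure E :=
  Measure.count.restrict φ

/-! ### Counts and law of a Poisson point process -/

section PointProcess

variable {E Ω Ω' : Type*} [MeasurableSpace E] [MeasurableSpace Ω] [MeasurableSpace Ω']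

theorem countingMeasure_apply [MeasurableSingletonClass E] {φ B : Set E} (hφ : φ.Countable)
    (hB : MeasurableSet B) : countingMeasure φ B = (count φ B : ℝ≥0∞) := by
  rw [countingMeasure, Measure.restrict_apply hB,
    Measure.count_apply (hB.inter hφ.measurableSet), count, Set.inter_comm]

variable {Φ : Ω → Set E} {Ψ : Ω' → Set E} {ν : Measure E} {P : Measure Ω} {Q : Measure Ω'}

namespace IsPoissonPointProcess

theorem measurable_countingMeasure [MeasurableSingletonClass E]
    (h : IsPoissonPointProcess Φ ν P) : Measurable fun ω => countingMeasure (Φ ω) := by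
  refine Measure.measurable_of_measurable_coe _ fun B hB => ?_
  simp_rw [fun ω => countingMeasure_apply (h.countable ω) hB]
  exact (Measurable.of_discrete (f := fun n : ℕ∞ => (n : ℝ≥0∞))).comp (h.measurable_count B hB)

theorem lintegral_count (h : IsPoissonPointProcess Φ ν P) {B : Set E} (hB : MeasurableSet B)
    (hνB : ν B ≠ ⊤) : ∫⁻ ω, (count (Φ ω) B : ℝ≥0∞) ∂P = ν B := by
  have hm : Measurable fun n : ℕ∞ => (n : ℝ≥0∞) := .of_discrete
  rw [← lintegral_map hm (h.measurable_count B hB), h.map_count B hB hνB,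
    lintegral_map hm .of_discrete]
  simp [lintegral_natCast_poissonMeasure, hνB]

/-- Campbell's theorem: the mean measure of a Poisson point process is its intensity. -/
theorem bind_countingMeasure [MeasurableSingletonClass E] [SigmaFinite ν]
    (h : IsPoissonPointProcess Φ ν P) :
    P.bind (fun ω => countingMeasure (Φ ω)) = ν := by
  -- The Poisson mean is known only for sets of finite intensity, hence the restriction to spanning
  -- sets.
  refine Measure.ext_of_iUnion_eq_univ (iUnion_spanningSets ν) fun n => ?_
  refine Measure.ext fun B hB => ?_
  have hBn := hB.inter (measurableSet_spanningSets ν n)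
  rw [Measure.restrict_apply hB, Measure.restrict_apply hB,
    Measure.bind_apply hBn h.measurable_countingMeasure.aemeasurable]
  simp_rw [fun ω => countingMeasure_apply (h.countable ω) hBn]
  exact h.lintegral_count hBn
    (measure_ne_top_of_subset Set.inter_subset_right (measure_spanningSets_lt_top ν n).ne)

theorem lintegral_lintegral_countingMeasure [MeasurableSingletonClass E] [SigmaFinite ν]
    (h : IsPoissonPointProcess Φ ν P) {f : E → ℝ≥0∞} (hf : Measurable f) :
    ∫⁻ ω, ∫⁻ x, f x ∂countingMeasure (Φ ω) ∂P = ∫⁻ x, f x ∂ν := by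
  rw [← Measure.lintegral_bind h.measurable_countingMeasure.aemeasurable hf.aemeasurable,
    h.bind_countingMeasure]

theorem ae_count_ne_top (h : IsPoissonPointProcess Φ ν P) {B : Set E} (hB : MeasurableSet B)
    (hνB : ν B ≠ ⊤) : ∀ᵐ ω ∂P, count (Φ ω) B ≠ ⊤ := by
  have hm : Measurable fun ω => (count (Φ ω) B : ℝ≥0∞) :=
    (Measurable.of_discrete (f := fun n : ℕ∞ => (n : ℝ≥0∞))).comp (h.measurable_count B hB)
  have := ae_lt_top hm (by rw [h.lintegral_count hB hνB]; exact hνB)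
  filter_upwards [this] with ω hω htop
  simp [htop] at hω

theorem ae_count_eq_zero (h : IsPoissonPointProcess Φ ν P) {B : Set E} (hB : MeasurableSet B)
    (hνB : ν B = 0) : ∀ᵐ ω ∂P, count (Φ ω) B = 0 := by
  have hm : Measurable fun ω => (count (Φ ω) B : ℝ≥0∞) :=
    (Measurable.of_discrete (f := fun n : ℕ∞ => (n : ℝ≥0∞))).comp (h.measurable_count B hB)
  have := h.lintegral_count hB (by simp [hνB])
  rw [hνB, lintegral_eq_zero_iff hm] at this
  filter_upwards [this] with ω hω
  simpa using hω

theorem measure_count_eq_zero (h : IsPoissonPointProcess Φ ν P) {B : Set E} (hB : MeasurableSet B)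
    (hνB : ν B ≠ ⊤) :
    P {ω | count (Φ ω) B = 0} = ENNReal.ofReal (Real.exp (-(ν B).toReal)) := by
  have h1 : P {ω | count (Φ ω) B = 0} = P.map (fun ω => count (Φ ω) B) {0} := by
    rw [Measure.map_apply (h.measurable_count B hB) (measurableSet_singleton _)]
    rfl
  have h2 : (fun n : ℕ => (n : ℕ∞)) ⁻¹' {0} = {0} := by ext; simp
  rw [h1, h.map_count B hB hνB, Measure.map_apply .of_discrete (measurableSet_singleton _), h2,
    poissonMeasure_singleton]
  simp [ENNReal.toReal]

/-- By σ-finiteness B contains sets C of arbitrarily large finite intensity, and each void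
probability e^(-ν C) bounds that of B. -/
theorem ae_count_ne_zero [SigmaFinite ν] (h : IsPoissonPointProcess Φ ν P) {B : Set E}
    (hB : MeasurableSet B) (hνB : ν B = ⊤) : ∀ᵐ ω ∂P, count (Φ ω) B ≠ 0 := by
  have hle : ∀ n : ℕ, P {ω | count (Φ ω) B = 0} ≤ ENNReal.ofReal (Real.exp (-(n : ℝ))) := by
    intro n
    obtain ⟨C, hC, hCB, hn, hCtop⟩ := Measure.exists_subset_measure_lt_top (r := n) hB
      (by rw [hνB]; exact ENNReal.natCast_lt_top n)
    calc P {ω | count (Φ ω) B = 0} ≤ P {ω | count (Φ ω) C = 0} := by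
          refine measure_mono fun ω hω => ?_
          simp only [count, Set.mem_ofPred_eq, Set.encard_eq_zero] at hω ⊢
          exact Set.subset_empty_iff.1 (hω ▸ Set.inter_subset_inter_right _ hCB)
      _ = ENNReal.ofReal (Real.exp (-(ν C).toReal)) := h.measure_count_eq_zero hC hCtop.ne
      _ ≤ _ := by
          refine ENNReal.ofReal_le_ofReal (Real.exp_le_exp.2 (neg_le_neg ?_))
          simpa using ENNReal.toReal_mono hCtop.ne hn.le
  have hlim : Filter.Tendsto (fun n : ℕ => ENNReal.ofReal (Real.exp (-(n : ℝ)))) Filter.atTop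
      (nhds 0) := by
    have := ENNReal.tendsto_ofReal
      (Real.tendsto_exp_neg_atTop_nhds_zero.comp tendsto_natCast_atTop_atTop)
    simpa [Function.comp_def] using this
  rw [ae_iff]
  simpa using ge_of_tendsto' hlim hle

/-- Finitely many points of B would all lie in one spanning set, yet B minus that set still has
infinite intensity and so almost surely contains a point. -/
theorem ae_count_eq_top [SigmaFinite ν] (h : IsPoissonPointProcess Φ ν P) {B : Set E}
    (hB : MeasurableSet B) (hνB : ν B = ⊤) : ∀ᵐ ω ∂P, count (Φ ω) B = ⊤ := by
  have hdiff : ∀ n, ν (B \ spanningSets ν n) = ⊤ := fun n => by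
    rw [measure_sdiff_eq_top hνB (measure_spanningSets_lt_top ν n).ne]
  have hae := ae_all_iff.2 fun n =>
    h.ae_count_ne_zero (hB.diff (measurableSet_spanningSets ν n)) (hdiff n)
  filter_upwards [hae] with ω hω
  by_contra hfin
  have hfin' : (Φ ω ∩ B).Finite := Set.encard_ne_top_iff.1 hfin
  obtain ⟨N, hN⟩ : ∃ N, ∀ x ∈ Φ ω ∩ B, x ∈ spanningSets ν N := by
    have hdir : Directed (· ⊆ ·) (spanningSets ν) := (monotone_spanningSets ν).directed_le
    have := hdir.exists_mem_subset_of_finset_subset_biUnion (s := hfin'.toFinset)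
      (by rw [iUnion_spanningSets]; exact Set.subset_univ _)
    obtain ⟨N, hN⟩ := this
    exact ⟨N, fun x hx => hN (by simpa using hx)⟩
  refine hω N ?_
  rw [count, Set.encard_eq_zero, Set.eq_empty_iff_forall_notMem]
  exact fun x hx => hx.2.2 (hN x ⟨hx.1, hx.2.1⟩)

theorem identDistrib_count [SigmaFinite ν] [IsProbabilityMeasure P] [IsProbabilityMeasure Q]
    (hΦ : IsPoissonPointProcess Φ ν P) (hΨ : IsPoissonPointProcess Ψ ν Q) {B : Set E}
    (hB : MeasurableSet B) :
    IdentDistrib (fun ω => count (Φ ω) B) (fun ω => count (Ψ ω) B) P Q where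
  aemeasurable_fst := (hΦ.measurable_count B hB).aemeasurable
  aemeasurable_snd := (hΨ.measurable_count B hB).aemeasurable
  map_eq := by
    by_cases hνB : ν B = ⊤
    · rw [Measure.map_congr (hΦ.ae_count_eq_top hB hνB), Measure.map_congr (hΨ.ae_count_eq_top hB hνB)]
      simp
    · rw [hΦ.map_count B hB hνB, hΨ.map_count B hB hνB]

theorem iIndepFun_count {ι : Type*} [Fintype ι] (h : IsPoissonPointProcess Φ ν P) {B : ι → Set E}
    (hB : ∀ i, MeasurableSet (B i)) (hd : Pairwise (Function.onFun Disjoint B)) :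
    iIndepFun (fun i ω => count (Φ ω) (B i)) P := by
  let e := Fintype.equivFin ι
  have := h.indep_count _ (fun k => B (e.symm k)) (fun _ => hB _)
    (fun i j hij => hd (e.symm.injective.ne hij))
  have := this.precomp e.injective
  simpa using this

/-- The joint law of the numbers of points in finitely many sets, which need not be disjoint,
depends only on the intensity. -/
theorem identDistrib_countingMeasure_pi [MeasurableSingletonClass E] [SigmaFinite ν]
    [IsProbabilityMeasure P] [IsProbabilityMeasure Q]
    (hΦ : IsPoissonPointProcess Φ ν P) (hΨ : IsPoissonPointProcess Ψ ν Q)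
    {ι : Type*} [Finite ι] {B : ι → Set E} (hB : ∀ i, MeasurableSet (B i)) :
    IdentDistrib (fun ω i => countingMeasure (Φ ω) (B i))
      (fun ω i => countingMeasure (Ψ ω) (B i)) P Q := by
  classical
  have := Fintype.ofFinite ι
  -- σ records which of the sets contain a point. Its fibres are disjoint atoms, with independent
  -- counts, and each B i is a finite union of them.
  let σ : E → ι → Prop := fun x i => x ∈ B i
  have hσ : Measurable σ := measurable_pi_lambda _ fun i => measurable_mem.2 (hB i)
  have hA : ∀ J : ι → Prop, MeasurableSet (σ ⁻¹' {J}) := fun J => hσ (measurableSet_singleton J)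
  have hd : Pairwise (Function.onFun Disjoint fun J : ι → Prop => σ ⁻¹' {J}) := fun I J hIJ =>
    Disjoint.preimage _ (by simpa using hIJ)
  have hpi := IdentDistrib.pi (fun J => identDistrib_count hΦ hΨ (hA J))
    (hΦ.iIndepFun_count hA hd) (hΨ.iIndepFun_count hA hd)
  let g : ((ι → Prop) → ℕ∞) → ι → ℝ≥0∞ := fun c i => ∑ J with J i, (c J : ℝ≥0∞)
  have hg : Measurable g := by
    refine measurable_pi_lambda _ fun i => Finset.measurable_sum _ fun J _ => ?_
    exact (Measurable.of_discrete (f := fun n : ℕ∞ => (n : ℝ≥0∞))).comp (measurable_pi_apply J)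
  have key : ∀ φ : Set E, φ.Countable →
      (fun i => countingMeasure φ (B i)) = g fun J => count φ (σ ⁻¹' {J}) := by
    intro φ hφ
    funext i
    have hBi : B i = ⋃ J ∈ Finset.univ.filter fun J : ι → Prop => J i, σ ⁻¹' {J} := by
      ext x
      simp [σ]
    conv_lhs => rw [hBi]
    rw [measure_biUnion_finset (fun I _ J _ hIJ => hd hIJ) fun J _ => hA J]
    exact Finset.sum_congr rfl fun J _ => countingMeasure_apply hφ (hA J)
  have := hpi.comp hg
  rw [funext fun ω => key (Φ ω) (hΦ.countable ω), funext fun ω => key (Ψ ω) (hΨ.countable ω)]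
  exact this

/-- The law of a Poisson point process, as a random measure, depends only on the intensity. -/
theorem identDistrib_countingMeasure [MeasurableSingletonClass E] [SigmaFinite ν]
    [IsProbabilityMeasure P] [IsProbabilityMeasure Q]
    (hΦ : IsPoissonPointProcess Φ ν P) (hΨ : IsPoissonPointProcess Ψ ν Q) :
    IdentDistrib (fun ω => countingMeasure (Φ ω)) (fun ω => countingMeasure (Ψ ω)) P Q where
  aemeasurable_fst := hΦ.measurable_countingMeasure.aemeasurable
  aemeasurable_snd := hΨ.measurable_countingMeasure.aemeasurable
  map_eq := by
    let ev : Measure E → {B : Set E // MeasurableSet B} → ℝ≥0∞ := fun μ B => μ B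
    have hev : Measurable ev := measurable_pi_lambda _ fun B => Measure.measurable_coe B.2
    have hX : AEMeasurable (fun ω B => ev (countingMeasure (Φ ω)) B) P :=
      (hev.comp hΦ.measurable_countingMeasure).aemeasurable
    have hY : AEMeasurable (fun ω B => ev (countingMeasure (Ψ ω)) B) Q :=
      (hev.comp hΨ.measurable_countingMeasure).aemeasurable
    have hlaw : P.map (fun ω => ev (countingMeasure (Φ ω))) =
        Q.map (fun ω => ev (countingMeasure (Ψ ω))) := by
      have hX' := isProjectiveLimit_map hX
      have hfd : ∀ I : Finset {B : Set E // MeasurableSet B},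
          P.map (fun ω => I.restrict fun B => ev (countingMeasure (Φ ω)) B) =
          Q.map (fun ω => I.restrict fun B => ev (countingMeasure (Ψ ω)) B) := fun I =>
        (identDistrib_countingMeasure_pi hΦ hΨ (fun i : I => i.1.2)).map_eq
      exact IsProjectiveLimit.unique (fun I => (hX' I).trans (hfd I)) (isProjectiveLimit_map hY)
    -- The σ-algebra on measures is generated by the evaluations, so equality of the laws of all
    -- evaluations suffices.
    have hcomap : ∀ A : Set (Measure E), MeasurableSet A →
        ∃ A', MeasurableSet A' ∧ ev ⁻¹' A' = A := by
      have hle : Measure.instMeasurableSpace ≤ MeasurableSpace.comap ev inferInstance := by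
        refine iSup₂_le fun B hB => ?_
        refine Measurable.comap_le ?_
        exact (measurable_pi_apply (⟨B, hB⟩ : {B : Set E // MeasurableSet B})).comp
          (comap_measurable ev)
      exact fun A hA => hle A hA
    refine Measure.ext fun A hA => ?_
    obtain ⟨A', hA', rfl⟩ := hcomap A hA
    have h1 := DFunLike.congr_fun hlaw A'
    rw [Measure.map_apply_of_aemeasurable hX hA', Measure.map_apply_of_aemeasurable hY hA'] at h1
    rw [Measure.map_apply hΦ.measurable_countingMeasure hA,
      Measure.map_apply hΨ.measurable_countingMeasure hA]
    exact h1

end IsPoissonPointProcess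

end PointProcess

/-! ### Deterministic configurations and monotonicity in the exponent -/

section Configuration

variable {E : Type*} [NormedAddCommGroup E] {φ : Set E} {h : ℝ → ℝ} {ε : ℝ} {s x : E}

theorem receivedPower_powerLaw_nonneg (ε : ℝ) (x : E) : 0 ≤ receivedPower (powerLaw ε) x :=
  one_div_nonneg.2 (Real.rpow_nonneg (norm_nonneg x) ε)

theorem receivedPower_powerLaw_pos (ε : ℝ) (hx : x ≠ 0) : 0 < receivedPower (powerLaw ε) x :=
  one_div_pos.2 (Real.rpow_pos_of_pos (norm_pos_iff.2 hx) ε)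

theorem receivedPower_powerLaw_le_iff (hε : 0 < ε) (hs : s ≠ 0) (hx : x ≠ 0) :
    receivedPower (powerLaw ε) x ≤ receivedPower (powerLaw ε) s ↔ ‖s‖ ≤ ‖x‖ := by
  have hs' := norm_pos_iff.2 hs
  have hx' := norm_pos_iff.2 hx
  rw [receivedPower, receivedPower, powerLaw, powerLaw,
    one_div_le_one_div (Real.rpow_pos_of_pos hx' ε) (Real.rpow_pos_of_pos hs' ε),
    Real.rpow_le_rpow_iff hs'.le hx'.le hε]

theorem isServing_powerLaw_iff (hε : 0 < ε) (h0 : (0 : E) ∉ φ) :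
    IsServing (powerLaw ε) φ s ↔ s ∈ φ ∧ ∀ x ∈ φ, ‖s‖ ≤ ‖x‖ := by
  refine and_congr_right fun hs => forall₂_congr fun x hx => ?_
  exact receivedPower_powerLaw_le_iff hε (ne_of_mem_of_not_mem hs h0) (ne_of_mem_of_not_mem hx h0)

theorem exists_isServing_powerLaw (hε : 0 < ε) (h0 : (0 : E) ∉ φ) (hne : φ.Nonempty)
    (hfin : ∀ r : ℝ, (φ ∩ Metric.closedBall 0 r).Finite) : ∃ s, IsServing (powerLaw ε) φ s := by
  obtain ⟨y, hy⟩ := hne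
  obtain ⟨s, hs, hmin⟩ := Set.exists_min_image _ (fun x : E => ‖x‖) (hfin ‖y‖)
    ⟨y, hy, by simp⟩
  refine ⟨s, (isServing_powerLaw_iff hε h0).2 ⟨hs.1, fun x hx => ?_⟩⟩
  by_cases hxy : ‖x‖ ≤ ‖y‖
  · exact hmin x ⟨hx, by simpa using hxy⟩
  · exact (hmin y ⟨hy, by simp⟩).trans (not_le.1 hxy).le

theorem isServing_servingBS (hs : ∃ s, IsServing h φ s) : IsServing h φ (servingBS h φ) := by
  rw [servingBS, dif_pos hs]
  exact hs.choose_spec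

theorem ratioWellDefined_powerLaw (hε : 0 < ε) (h0 : (0 : E) ∉ φ) (hinf : φ.Infinite)
    (hfin : ∀ r : ℝ, (φ ∩ Metric.closedBall 0 r).Finite)
    (hsum : Summable fun x : φ => receivedPower (powerLaw ε) (x : E)) :
    RatioWellDefined (powerLaw ε) φ := by
  have hsum' : Summable fun x : ↥(φ \ {servingBS (powerLaw ε) φ}) =>
      receivedPower (powerLaw ε) (x : E) :=
    Summable.comp_injective (i := Set.inclusion Set.sdiff_subset) hsum
      (Set.inclusion_injective Set.sdiff_subset)
  refine ⟨h0, exists_isServing_powerLaw hε h0 hinf.nonempty hfin, hsum', ?_⟩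
  obtain ⟨y, hy⟩ := (hinf.sdiff (Set.finite_singleton (servingBS (powerLaw ε) φ))).nonempty
  exact hsum'.tsum_pos (fun x => receivedPower_powerLaw_nonneg ε _) ⟨y, hy⟩
    (receivedPower_powerLaw_pos ε (ne_of_mem_of_not_mem hy.1 h0))

namespace RatioWellDefined

theorem isServing (hw : RatioWellDefined h φ) : IsServing h φ (servingBS h φ) :=
  isServing_servingBS hw.exists_serving

theorem hasSum_receivedPower (hw : RatioWellDefined h φ) :
    HasSum (fun x : φ => receivedPower h (x : E))
      (receivedPower h (servingBS h φ) + interference h φ) := by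
  have h1 : HasSum (fun x : ({servingBS h φ} : Set E) => receivedPower h (x : E))
      (receivedPower h (servingBS h φ)) := by
    simpa using hasSum_unique fun x : ({servingBS h φ} : Set E) => receivedPower h (x : E)
  have h2 := HasSum.add_disjoint (f := fun x : E => receivedPower h x)
    Set.disjoint_sdiff_right h1 hw.summable.hasSum
  rwa [Set.union_sdiff_cancel (Set.singleton_subset_iff.2 hw.isServing.1)] at h2

/-- In a fixed configuration, a larger path-loss exponent gives a larger
carrier-to-interference ratio. -/
theorem carrierToInterference_powerLaw_mono {ε₁ ε₂ : ℝ} (hε₂ : 0 < ε₂) (hε : ε₂ ≤ ε₁)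
    (h₁ : RatioWellDefined (powerLaw ε₁) φ) (h₂ : RatioWellDefined (powerLaw ε₂) φ) :
    carrierToInterference (powerLaw ε₂) φ ≤ carrierToInterference (powerLaw ε₁) φ := by
  have hS₁ := (isServing_powerLaw_iff (hε₂.trans_le hε) h₁.zero_notMem).1 h₁.isServing
  have hS₂ := (isServing_powerLaw_iff hε₂ h₂.zero_notMem).1 h₂.isServing
  set S₁ := servingBS (powerLaw ε₁) φ
  set S₂ := servingBS (powerLaw ε₂) φ
  have hR : ‖S₂‖ = ‖S₁‖ := le_antisymm (hS₂.2 _ hS₁.1) (hS₁.2 _ hS₂.1)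
  have hR0 : 0 < ‖S₁‖ := norm_pos_iff.2 (ne_of_mem_of_not_mem hS₁.1 h₁.zero_notMem)
  rw [carrierToInterference, carrierToInterference,
    div_le_div_iff₀ h₂.interference_pos h₁.interference_pos]
  -- Compare C₂(C₁ + I₁) with C₁(C₂ + I₂) term by term over all of φ; the product C₁C₂ then cancels.
  -- Including the server avoids matching index sets that may differ when several stations are
  -- nearest.
  have hle := hasSum_le (fun x : φ => ?_)
    (h₁.hasSum_receivedPower.mul_left (receivedPower (powerLaw ε₂) S₂))
    (h₂.hasSum_receivedPower.mul_left (receivedPower (powerLaw ε₁) S₁))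
  · linarith
  · have hx0 : 0 < ‖(x : E)‖ := hR0.trans_le (hS₁.2 _ x.2)
    simp only [receivedPower, powerLaw, hR]
    rw [div_mul_div_comm, div_mul_div_comm, one_mul]
    refine one_div_le_one_div_of_le (by positivity) ?_
    have hx : ‖(x : E)‖ ^ ε₁ = ‖(x : E)‖ ^ (ε₁ - ε₂) * ‖(x : E)‖ ^ ε₂ := by
      rw [← Real.rpow_add hx0, sub_add_cancel]
    have hS : ‖S₁‖ ^ ε₁ = ‖S₁‖ ^ (ε₁ - ε₂) * ‖S₁‖ ^ ε₂ := by
      rw [← Real.rpow_add hR0, sub_add_cancel]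
    have hmono : ‖S₁‖ ^ (ε₁ - ε₂) ≤ ‖(x : E)‖ ^ (ε₁ - ε₂) :=
      Real.rpow_le_rpow hR0.le (hS₁.2 _ x.2) (sub_nonneg.2 hε)
    rw [hx, hS]
    calc ‖S₁‖ ^ (ε₁ - ε₂) * ‖S₁‖ ^ ε₂ * ‖(x : E)‖ ^ ε₂
        ≤ ‖(x : E)‖ ^ (ε₁ - ε₂) * ‖S₁‖ ^ ε₂ * ‖(x : E)‖ ^ ε₂ := by gcongr
      _ = _ := by ring

end RatioWellDefined

end Configuration

/-! ### The ratio as a measurable function of the counting measure -/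

section Measurability

variable {E : Type*} [MeasurableSpace E]

theorem measurable_essSup {f : E → ℝ≥0∞} (hf : Measurable f) :
    Measurable fun μ : Measure E => essSup f μ := by
  refine measurable_of_Iic fun a => ?_
  have : (fun μ : Measure E => essSup f μ) ⁻¹' Set.Iic a = {μ | μ {x | a < f x} = 0} := by
    ext μ
    have hae : (∀ᵐ x ∂μ, f x ≤ a) ↔ μ {x | a < f x} = 0 := by simp [ae_iff]
    simp only [Set.mem_preimage, Set.mem_Iic, Set.mem_ofPred_eq, ← hae]
    exact ⟨fun h => (ENNReal.ae_le_essSup f).mono fun x hx => hx.trans h,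
      fun h => essSup_le_of_ae_le a h⟩
  rw [this]
  exact Measure.measurable_coe (measurableSet_lt measurable_const hf) (measurableSet_singleton 0)

/-- The carrier-to-interference ratio as a function of the counting measure of the base stations:
the largest received power divided by the total of all the other ones. -/
noncomputable def ratioOfMeasure (p : E → ℝ) (μ : Measure E) : ℝ :=
  (essSup (fun x => ENNReal.ofReal (p x)) μ).toReal /
    ((∫⁻ x, ENNReal.ofReal (p x) ∂μ).toReal - (essSup (fun x => ENNReal.ofReal (p x)) μ).toReal)

theorem measurable_ratioOfMeasure {p : E → ℝ} (hp : Measurable p) :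
    Measurable (ratioOfMeasure p) := by
  have h1 := (measurable_essSup hp.ennreal_ofReal).ennreal_toReal
  have h2 := (Measure.measurable_lintegral hp.ennreal_ofReal).ennreal_toReal
  exact h1.div (h2.sub h1)

theorem lintegral_countingMeasure [MeasurableSingletonClass E] {φ : Set E} (hφ : φ.Countable)
    (f : E → ℝ≥0∞) : ∫⁻ x, f x ∂countingMeasure φ = ∑' x : φ, f x := by
  simp [countingMeasure, lintegral_countable f hφ]

/-- Every point of φ is an atom of positive mass, so the essential supremum cannot miss the maximum.
-/
theorem essSup_countingMeasure_eq [MeasurableSingletonClass E] {φ : Set E} (hφ : φ.Countable)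
    {f : E → ℝ≥0∞} {s : E} (hs : s ∈ φ) (hmax : ∀ x ∈ φ, f x ≤ f s) :
    essSup f (countingMeasure φ) = f s := by
  refine le_antisymm (essSup_le_of_ae_le _ ?_) ?_
  · exact (ae_restrict_mem hφ.measurableSet).mono hmax
  · by_contra! hlt
    have hae : ∀ᵐ x ∂countingMeasure φ, x ≠ s :=
      (ENNReal.ae_le_essSup f).mono fun x hx hxs => (hxs ▸ hx).not_gt hlt
    have : countingMeasure φ {s} = 0 := by simpa [ae_iff] using hae
    rw [countingMeasure_apply hφ (measurableSet_singleton s), count,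
      Set.inter_eq_right.2 (Set.singleton_subset_iff.2 hs)] at this
    simp at this

theorem RatioWellDefined.ratioOfMeasure_eq {E : Type*} [NormedAddCommGroup E] [MeasurableSpace E]
    [MeasurableSingletonClass E] {φ : Set E} {h : ℝ → ℝ} (hφ : φ.Countable)
    (hw : RatioWellDefined h φ) (hnn : ∀ x : E, 0 ≤ receivedPower h x) :
    ratioOfMeasure (receivedPower h) (countingMeasure φ) = carrierToInterference h φ := by
  have hess := essSup_countingMeasure_eq hφ (f := fun x : E => ENNReal.ofReal (receivedPower h x))
    hw.isServing.1 fun x hx => ENNReal.ofReal_le_ofReal (hw.isServing.2 x hx)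
  have hsum := hw.hasSum_receivedPower
  rw [ratioOfMeasure, hess, lintegral_countingMeasure hφ,
    ← ENNReal.ofReal_tsum_of_nonneg (fun x => hnn _) hsum.summable, hsum.tsum_eq,
    ENNReal.toReal_ofReal (hnn _), ENNReal.toReal_ofReal (add_nonneg (hnn _) hw.interference_pos.le),
    add_sub_cancel_left, carrierToInterference]

theorem measurable_receivedPower_powerLaw {E : Type*} [NormedAddCommGroup E] [MeasurableSpace E]
    [OpensMeasurableSpace E] (ε : ℝ) : Measurable (receivedPower (E := E) (powerLaw ε)) := by
  unfold receivedPower powerLaw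
  fun_prop

end Measurability

/-! ### Almost sure well-definedness and law of the ratio -/

section HomogeneousSCS

instance sigmaFinite_ofReal_smul {E : Type*} [MeasurableSpace E] (μ : Measure E) [SigmaFinite μ]
    (c : ℝ) : SigmaFinite (ENNReal.ofReal c • μ) :=
  inferInstanceAs (SigmaFinite (c.toNNReal • μ))

variable {l : ℕ} {Ω Ω' : Type*} [MeasurableSpace Ω] [MeasurableSpace Ω'] {P : Measure Ω}
  {Q : Measure Ω'} {Φ : Ω → Set (EuclideanSpace ℝ (Fin l))}
  {Ψ : Ω' → Set (EuclideanSpace ℝ (Fin l))} {lam ε : ℝ}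

namespace IsHomogeneousSCS

theorem ae_finite_inter_closedBall (hΦ : IsHomogeneousSCS Φ lam P) :
    ∀ᵐ ω ∂P, ∀ r : ℝ, (Φ ω ∩ Metric.closedBall 0 r).Finite := by
  have hae := ae_all_iff.2 fun n : ℕ => IsPoissonPointProcess.ae_count_ne_top hΦ
    (B := Metric.closedBall 0 (n : ℝ)) measurableSet_closedBall
    (ENNReal.mul_ne_top ENNReal.ofReal_ne_top measure_closedBall_lt_top.ne)
  filter_upwards [hae] with ω hω r
  obtain ⟨n, hn⟩ := exists_nat_ge r
  exact (Set.encard_ne_top_iff.1 (hω n)).subset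
    (Set.inter_subset_inter_right _ (Metric.closedBall_subset_closedBall hn))

theorem ae_zero_notMem (hl : 1 ≤ l) (hΦ : IsHomogeneousSCS Φ lam P) :
    ∀ᵐ ω ∂P, (0 : EuclideanSpace ℝ (Fin l)) ∉ Φ ω := by
  have : Nonempty (Fin l) := ⟨⟨0, hl⟩⟩
  have hae := IsPoissonPointProcess.ae_count_eq_zero hΦ
    (B := {0}) (measurableSet_singleton _) (by simp)
  filter_upwards [hae] with ω hω h0
  rw [count, Set.encard_eq_zero] at hω
  exact Set.eq_empty_iff_forall_notMem.1 hω 0 ⟨h0, rfl⟩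

theorem ae_infinite (hl : 1 ≤ l) (hlam : 0 < lam) (hΦ : IsHomogeneousSCS Φ lam P) :
    ∀ᵐ ω ∂P, (Φ ω).Infinite := by
  have : Nonempty (Fin l) := ⟨⟨0, hl⟩⟩
  have hae := IsPoissonPointProcess.ae_count_eq_top hΦ MeasurableSet.univ (by simp [hlam])
  filter_upwards [hae] with ω hω
  simpa [count] using hω

theorem ae_summable_receivedPower (hε : (l : ℝ) < ε) (hΦ : IsHomogeneousSCS Φ lam P) :
    ∀ᵐ ω ∂P, Summable fun x : Φ ω =>
      receivedPower (powerLaw ε) (x : EuclideanSpace ℝ (Fin l)) := by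
  -- The path loss itself is not integrable near the origin when ε > l; the bounded substitute (1 +
  -- |x|)^(-ε) has the same decay at infinity.
  have hint : Integrable (fun x : EuclideanSpace ℝ (Fin l) => (1 + ‖x‖) ^ (-ε))
      (ENNReal.ofReal lam • volume) :=
    (integrable_one_add_norm (by simpa using hε)).smul_measure ENNReal.ofReal_ne_top
  have hmeas : Measurable fun x : EuclideanSpace ℝ (Fin l) => ENNReal.ofReal ((1 + ‖x‖) ^ (-ε)) := by
    fun_prop
  have hmean := IsPoissonPointProcess.lintegral_lintegral_countingMeasure hΦ hmeas
  have hfin := ae_lt_top ((Measure.measurable_lintegral hmeas).comp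
    (IsPoissonPointProcess.measurable_countingMeasure hΦ))
    (hmean.trans_lt hint.lintegral_lt_top).ne
  have hε0 : 0 < ε := (Nat.cast_nonneg l).trans_lt hε
  filter_upwards [hfin, hΦ.ae_finite_inter_closedBall] with ω hω hball
  rw [Function.comp_apply, lintegral_countingMeasure (hΦ.countable ω)] at hω
  have hsum : Summable fun x : Φ ω => (1 + ‖(x : EuclideanSpace ℝ (Fin l))‖) ^ (-ε) := by
    have := ENNReal.summable_toReal hω.ne
    refine this.congr fun x => ENNReal.toReal_ofReal (by positivity)
  -- Only finitely many stations have |x| ≤ 1; for the others 1 + |x| ≤ 2|x|, which gives the factor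
  -- 2^ε.
  refine Summable.of_norm_bounded_eventually (hsum.mul_left (2 ^ ε)) ?_
  have hcof : {x : Φ ω | ‖(x : EuclideanSpace ℝ (Fin l))‖ ≤ 1}.Finite := by
    refine Set.Finite.of_finite_image ((hball 1).subset ?_) Subtype.val_injective.injOn
    rintro _ ⟨x, hx, rfl⟩
    exact ⟨x.2, by simpa using hx⟩
  filter_upwards [hcof.compl_mem_cofinite] with x hx
  have hx1 : 1 < ‖(x : EuclideanSpace ℝ (Fin l))‖ := by simpa using hx
  rw [Real.norm_of_nonneg (receivedPower_powerLaw_nonneg ε _), receivedPower, powerLaw,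
    Real.rpow_neg (by positivity), ← div_eq_mul_inv, ← Real.div_rpow (by norm_num) (by positivity),
    ← Real.one_rpow ε, ← Real.div_rpow (by norm_num) (by positivity)]
  refine Real.rpow_le_rpow (by positivity) ?_ hε0.le
  rw [Real.one_rpow, div_le_div_iff₀ (by positivity) (by positivity)]
  linarith

theorem ae_ratioWellDefined (hl : 1 ≤ l) (hlam : 0 < lam) (hε : (l : ℝ) < ε)
    (hΦ : IsHomogeneousSCS Φ lam P) : ∀ᵐ ω ∂P, RatioWellDefined (powerLaw ε) (Φ ω) := by
  filter_upwards [hΦ.ae_zero_notMem hl, hΦ.ae_infinite hl hlam, hΦ.ae_finite_inter_closedBall,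
    hΦ.ae_summable_receivedPower hε] with ω h0 hinf hfin hsum
  exact ratioWellDefined_powerLaw ((Nat.cast_nonneg l).trans_lt hε) h0 hinf hfin hsum

theorem ae_ratioOfMeasure_eq (hl : 1 ≤ l) (hlam : 0 < lam) (hε : (l : ℝ) < ε)
    (hΦ : IsHomogeneousSCS Φ lam P) :
    (fun ω => ratioOfMeasure (receivedPower (powerLaw ε)) (countingMeasure (Φ ω))) =ᵐ[P]
      fun ω => carrierToInterference (powerLaw ε) (Φ ω) := by
  filter_upwards [hΦ.ae_ratioWellDefined hl hlam hε] with ω hω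
  exact hω.ratioOfMeasure_eq (hΦ.countable ω) (receivedPower_powerLaw_nonneg ε)

/-- The law of the carrier-to-interference ratio depends only on the base station density. -/
theorem identDistrib_carrierToInterference [IsProbabilityMeasure P] [IsProbabilityMeasure Q]
    (hl : 1 ≤ l) (hlam : 0 < lam) (hε : (l : ℝ) < ε)
    (hΦ : IsHomogeneousSCS Φ lam P) (hΨ : IsHomogeneousSCS Ψ lam Q) :
    IdentDistrib (fun ω => carrierToInterference (powerLaw ε) (Φ ω))
      (fun ω => carrierToInterference (powerLaw ε) (Ψ ω)) P Q := by
  have hR := measurable_ratioOfMeasure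
    (measurable_receivedPower_powerLaw (E := EuclideanSpace ℝ (Fin l)) ε)
  have hid := (IsPoissonPointProcess.identDistrib_countingMeasure hΦ hΨ).comp hR
  exact (IdentDistrib.of_ae_eq hid.aemeasurable_fst (hΦ.ae_ratioOfMeasure_eq hl hlam hε)).symm.trans
    (hid.trans (IdentDistrib.of_ae_eq hid.aemeasurable_snd (hΨ.ae_ratioOfMeasure_eq hl hlam hε)))

end IsHomogeneousSCS

end HomogeneousSCS

end Shotgun

theorem mainTheorem7 {l : ℕ} (hl : 1 ≤ l) {lam : ℝ} (hlam : 0 < lam)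
    {ε₁ ε₂ : ℝ} (hε₂ : (l : ℝ) < ε₂) (hε₁ : ε₂ < ε₁)
    {Ω₁ Ω₂ : Type*} [MeasurableSpace Ω₁] [MeasurableSpace Ω₂]
    (P₁ : Measure Ω₁) (P₂ : Measure Ω₂) [IsProbabilityMeasure P₁] [IsProbabilityMeasure P₂]
    (Φ₁ : Ω₁ → Set (EuclideanSpace ℝ (Fin l))) (Φ₂ : Ω₂ → Set (EuclideanSpace ℝ (Fin l)))
    (hΦ₁ : Shotgun.IsHomogeneousSCS Φ₁ lam P₁) (hΦ₂ : Shotgun.IsHomogeneousSCS Φ₂ lam P₂) :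
    (∀ᵐ ω ∂P₁, Shotgun.RatioWellDefined (Shotgun.powerLaw ε₁) (Φ₁ ω)) ∧
    (∀ᵐ ω ∂P₂, Shotgun.RatioWellDefined (Shotgun.powerLaw ε₂) (Φ₂ ω)) ∧
    Shotgun.StochLE
      (fun ω => Shotgun.carrierToInterference (Shotgun.powerLaw ε₂) (Φ₂ ω)) P₂
      (fun ω => Shotgun.carrierToInterference (Shotgun.powerLaw ε₁) (Φ₁ ω)) P₁ := by
  have hw₁ := hΦ₁.ae_ratioWellDefined hl hlam (hε₂.trans hε₁)
  have hid := hΦ₂.identDistrib_carrierToInterference hl hlam hε₂ hΦ₁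
  refine ⟨hw₁, hΦ₂.ae_ratioWellDefined hl hlam hε₂, hid.aemeasurable_fst,
    -- Comparing the first system with itself serves only to extract a.e. measurability, which is
    -- not immediate since the server is picked by choice.
    (hΦ₁.identDistrib_carrierToInterference hl hlam (hε₂.trans hε₁) hΦ₁).aemeasurable_fst,
    fun x => ?_⟩
  calc P₂ {ω | x < Shotgun.carrierToInterference (Shotgun.powerLaw ε₂) (Φ₂ ω)}
      = P₁ {ω | x < Shotgun.carrierToInterference (Shotgun.powerLaw ε₂) (Φ₁ ω)} :=
        hid.measure_mem_eq measurableSet_Ioi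
    _ ≤ _ := by
        refine measure_mono_ae ?_
        filter_upwards [hw₁, hΦ₁.ae_ratioWellDefined hl hlam hε₂] with ω h₁ h₂ hx
        exact lt_of_lt_of_le hx (h₁.carrierToInterference_powerLaw_mono
          ((Nat.cast_nonneg l).trans_lt hε₂) hε₁.le h₂)
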